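/- Let $q>2$ be a prime power, let $Q$ be a quadratic form on a $6$-dimensional vector space over $\mathbb{F}_q$ defining an elliptic quadric $\mathcal{Q}=\mathsf{Q}^-(5,q)$ of $\mathrm{PG}(5,q)$ (that is, $Q$ is non-singular of Witt index $2$), and let $\perp$ be the associated polarity. Let $H$ be a hyperplane of $\mathrm{PG}(5,q)$ meeting $\mathcal{Q}$ in a parabolic quadric $\mathsf{Q}(4,q)$ (that is, $Q|_H$ is non-singular), and let $X=\mathcal{Q}\setminus H$. For points $u,v$ of $\mathcal{Q}$ write $u\sim v$ ($u$ and $v$ are collinear) if $u\neq v$ and $v\in u^\perp$. For $v\in X$ let $v^\sigma\in X$ be the unique second point of $\mathcal{Q}$ on the line joining $v$ to $H^\perp$, and let $R_3=\{(u,v)\in X\times X : u\sim v,\ u\not\sim v^\sigma\}$. For a finite graph $\Gamma$ with vertex set $\Omega$ and a real number $\theta$, a non-empty proper subset $Y$ of $\Omega$ is called an intriguing set of $\Gamma$ for the eigenvalue $\theta$ if there are integers $h_1,h_2\ge 0$ such that every vertex in $Y$ has exactly $h_1$ neighbours in $Y$ and every vertex not in $Y$ has exactly $h_2$ neighbours in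 $Y$, and the characteristic vector $\chi_Y\in\mathbb{R}^{\Omega}$ lies in $\langle j\rangle+V_\theta$, where $j$ is the all-ones vector and $V_\theta$ is the eigenspace of the adjacency matrix of $\Gamma$ for $\theta$. A tight set of $\mathcal{Q}$ is an intriguing set, for the eigenvalue $q-1$, of the collinearity graph $(\mathcal{Q},\sim)$. If $Y\subseteq X$ is an intriguing set of the graph $(X,R_3)$ for the eigenvalue $q-1$, then $Y$, regarded as a set of points of $\mathcal{Q}$, is a tight set of $\mathcal{Q}$. Moreover, every point of $H\cap\mathcal{Q}$ is collinear to exactly $|Y|/(q+1)$ points of $Y$. -/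

import Mathlib

open scoped LinearAlgebra.Projectivization

/-! ### Intriguing sets of finite graphs -/

section Graphs

variable {α : Type*}

/-- `Y` is an intriguing set of the graph `G`: there are integers `h₁, h₂ ≥ 0` such that every
vertex of `Y` is adjacent to exactly `h₁` vertices of `Y`, and every vertex outside `Y` is adjacent
to exactly `h₂` vertices of `Y`. -/
def SimpleGraph.IsIntriguing (G : SimpleGraph α) (Y : Set α) : Prop :=
  ∃ h₁ h₂ : ℕ, (∀ x ∈ Y, {y | y ∈ Y ∧ G.Adj x y}.ncard = h₁) ∧
    (∀ x, x ∉ Y → {y | y ∈ Y ∧ G.Adj x y}.ncard = h₂)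

open Classical in
/-- The eigenspace of the (real) adjacency matrix of `G` for `θ`. -/
noncomputable def SimpleGraph.adjEigenspace [Fintype α] (G : SimpleGraph α) (θ : ℝ) :
    Submodule ℝ (α → ℝ) :=
  Module.End.eigenspace (Matrix.toLin' (G.adjMatrix ℝ)) θ

/-- `Y` is an intriguing set of `G` for the eigenvalue `θ`: it is a non-empty proper subset of the
vertex set, it is intriguing, and its characteristic vector lies in the sum of the line spanned by
the all-ones vector and the eigenspace of `θ`. -/
def SimpleGraph.IsIntriguingFor [Fintype α] (G : SimpleGraph α) (θ : ℝ) (Y : Set α) : Prop :=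
  Y.Nonempty ∧ Y ≠ Set.univ ∧ G.IsIntriguing Y ∧
    Y.indicator (1 : α → ℝ) ∈ Submodule.span ℝ {(1 : α → ℝ)} ⊔ G.adjEigenspace θ

end Graphs

/-! ### The elliptic quadric and its collinearity graph -/

section Quadric

variable {K V : Type*} [Field K] [AddCommGroup V] [Module K V]

/-- `Q` defines an elliptic quadric `Q⁻(5,q)`: a non-singular quadratic form on a vector space of
dimension `6` whose Witt index (maximal dimension of a totally singular subspace) is `2`. In even
dimension non-singularity is the same as non-degeneracy of the polar form, in every
characteristic. -/
structure IsEllipticQuadric (Q : QuadraticForm K V) : Prop where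
  finrank_eq : Module.finrank K V = 6
  polar_nondegenerate : LinearMap.BilinForm.Nondegenerate Q.polarBilin
  exists_line : ∃ W : Submodule K V, Module.finrank K W = 2 ∧ ∀ w ∈ W, Q w = 0
  not_exists_plane : ¬ ∃ W : Submodule K V, Module.finrank K W = 3 ∧ ∀ w ∈ W, Q w = 0

/-- The hyperplane `H` meets the quadric in a parabolic quadric `Q(4,q)`: `H` has vector space
dimension `5` and the restriction of the quadratic form to `H` is non-singular. -/
structure IsParabolicHyperplane (Q : QuadraticForm K V) (H : Submodule K V) : Prop where
  finrank_eq : Module.finrank K H = 5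
  nondegenerate : (Q.restrict H).Nondegenerate

/-- The points of the quadric defined by `Q`. -/
abbrev QuadricPoint (Q : QuadraticForm K V) : Type _ :=
  {p : ℙ K V // ∀ v ∈ p.submodule, Q v = 0}

/-- The polar of a subspace with respect to the polarity associated with `Q`. -/
def perp (Q : QuadraticForm K V) (W : Submodule K V) : Submodule K V :=
  LinearMap.BilinForm.orthogonal Q.polarBilin W

/-- Two points of the quadric are collinear if they are distinct and perpendicular. -/
def collinearityGraph (Q : QuadraticForm K V) : SimpleGraph (QuadricPoint Q) where
  Adj p p' := p ≠ p' ∧ p'.1.submodule ≤ perp Q p.1.submodule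
  symm := ⟨by
    rintro p p' ⟨h, h'⟩
    refine ⟨h.symm, fun v hv w hw => ?_⟩
    have := h' hw v hv
    simpa [QuadraticMap.polar_comm] using this⟩
  loopless := ⟨fun p h => h.1 rfl⟩

noncomputable instance [Finite V] (Q : QuadraticForm K V) : Fintype (QuadricPoint Q) :=
  Fintype.ofFinite _

/-- A tight set of the elliptic quadric `Q⁻(5,q)`: an intriguing set of its collinearity graph for
the eigenvalue `q - 1`. -/
def IsTightSet [Fintype K] [Finite V] (Q : QuadraticForm K V) (Y : Set (QuadricPoint Q)) : Prop :=
  (collinearityGraph Q).IsIntriguingFor ((Fintype.card K : ℝ) - 1) Y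

/-! ### The points off a hyperplane and the Penttila--Williford relation `R₃` -/

/-- The set `X` of the points of the quadric that do not lie in `H`. -/
abbrev OffPoint (Q : QuadraticForm K V) (H : Submodule K V) : Type _ :=
  {p : QuadricPoint Q // ¬ p.1.submodule ≤ H}

noncomputable instance [Finite V] (Q : QuadraticForm K V) (H : Submodule K V) :
    Fintype (OffPoint Q H) :=
  Fintype.ofFinite _

section Conjugation

variable {Q : QuadraticForm K V} {H : Submodule K V}

theorem exists_pole (hQ : IsEllipticQuadric Q) (hH : IsParabolicHyperplane Q H) :
    ∃ h : V, perp Q H = K ∙ h ∧ Q h ≠ 0 ∧ ∀ v, QuadraticMap.polar Q v h = 0 ↔ v ∈ H := by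
  have : FiniteDimensional K V := Module.finite_of_finrank_pos (by rw [hQ.finrank_eq]; norm_num)
  have hrefl : LinearMap.IsRefl Q.polarBilin := fun x y hxy => by
    simpa [QuadraticMap.polar_comm] using hxy
  have h1 : Module.finrank K (perp Q H) = 1 := by
    have := LinearMap.BilinForm.finrank_orthogonal hQ.polar_nondegenerate H
    rw [hQ.finrank_eq, hH.finrank_eq] at this
    exact this
  obtain ⟨h, hne, hspan⟩ := finrank_eq_one_iff'.1 h1
  have hs : perp Q H = K ∙ (h : V) := by
    ext x
    rw [Submodule.mem_span_singleton]
    constructor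
    · intro hx
      obtain ⟨c, hc⟩ := hspan ⟨x, hx⟩
      exact ⟨c, by simpa using congrArg Subtype.val hc⟩
    · rintro ⟨c, rfl⟩
      exact (perp Q H).smul_mem c h.2
  have hmem : ∀ v, QuadraticMap.polar Q v h = 0 ↔ v ∈ H := by
    intro v
    constructor
    · intro hv
      rw [← LinearMap.BilinForm.orthogonal_orthogonal hQ.polar_nondegenerate hrefl H]
      intro n hn
      change n ∈ perp Q H at hn
      rw [hs, Submodule.mem_span_singleton] at hn
      obtain ⟨c, rfl⟩ := hn
      simp [QuadraticMap.polar_comm Q _ v, hv]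
    · intro hv
      simpa using h.2 v hv
  refine ⟨h, hs, fun h0 => hne ?_, hmem⟩
  have hh : (h : V) ∈ H := (hmem h).1 (by simp [QuadraticMap.polar_self, h0])
  have hr : (⟨h, hh⟩ : H) ∈ (Q.restrict H).radical := by
    refine ⟨by simpa using h0, ?_⟩
    ext n
    have := (hmem n).2 n.2
    rw [QuadraticMap.polar_comm] at this
    simpa [QuadraticMap.polar] using this
  rw [hH.nondegenerate.radical_eq_bot] at hr
  have := congrArg Subtype.val ((Submodule.mem_bot K).1 hr)
  exact Subtype.ext (by simpa using this)

/-- The line joining the pole of `H` to a point `p` of `X` contains exactly one further point of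
the quadric, and this point is again in `X`. -/
theorem existsUnique_conj (hQ : IsEllipticQuadric Q) (hH : IsParabolicHyperplane Q H)
    (p : OffPoint Q H) :
    ∃! p' : OffPoint Q H, p' ≠ p ∧ p'.1.1.submodule ≤ perp Q H ⊔ p.1.1.submodule := by
  obtain ⟨h, hs, hh, hmem⟩ := exists_pole hQ hH
  obtain ⟨⟨p, hp⟩, hpH⟩ := p
  have hpv := p.submodule_eq
  have hv0 := p.rep_nonzero
  set v := p.rep
  simp only [hpv, Submodule.span_singleton_le_iff_mem] at hpH
  have hQv : Q v = 0 := hp v (by rw [hpv]; exact Submodule.mem_span_singleton_self v)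
  have hB : QuadraticMap.polar Q v h ≠ 0 := fun h0 => hpH ((hmem v).1 h0)
  set B := QuadraticMap.polar Q v h with hBdef
  have hQc : ∀ a b : K, Q (a • v + b • h) = a * b * B + b * b * Q h := by
    intro a b
    rw [QuadraticMap.map_add Q, QuadraticMap.map_smul, QuadraticMap.map_smul,
      QuadraticMap.polar_smul_left, QuadraticMap.polar_smul_right, hQv, ← hBdef]
    simp only [smul_eq_mul]
    ring
  have hBc : ∀ a b : K, QuadraticMap.polar Q (a • v + b • h) h = a * B + b * (2 * Q h) := by
    intro a b
    rw [QuadraticMap.polar_add_left, QuadraticMap.polar_smul_left, QuadraticMap.polar_smul_left,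
      QuadraticMap.polar_self, ← hBdef]
    simp only [smul_eq_mul, nsmul_eq_mul, Nat.cast_ofNat]
  set v' := Q h • v + (-B) • h with hv'
  have hBv' : QuadraticMap.polar Q v' h ≠ 0 := by
    rw [hv', hBc]
    have : Q h * B + -B * (2 * Q h) = -(Q h * B) := by ring
    rw [this]
    exact neg_ne_zero.2 (mul_ne_zero hh hB)
  have hv'0 : v' ≠ 0 := fun h0 => hBv' (by rw [h0, QuadraticMap.polar_zero_left])
  refine ⟨⟨⟨Projectivization.mk K v' hv'0, ?_⟩, ?_⟩, ⟨?_, ?_⟩, ?_⟩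
  · intro x hx
    rw [Projectivization.submodule_mk, Submodule.mem_span_singleton] at hx
    obtain ⟨c, rfl⟩ := hx
    rw [QuadraticMap.map_smul, hv', hQc]
    simp only [smul_eq_mul]
    ring
  · simp only [Projectivization.submodule_mk, Submodule.span_singleton_le_iff_mem]
    exact fun hv'H => hBv' ((hmem _).2 hv'H)
  · intro heq
    have h1 : v' ∈ p.submodule := by
      have : (Projectivization.mk K v' hv'0) = p :=
        congrArg (fun x : OffPoint Q H => x.1.1) heq
      rw [← this, Projectivization.submodule_mk]
      exact Submodule.mem_span_singleton_self _
    rw [hpv, Submodule.mem_span_singleton] at h1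
    obtain ⟨c, hc⟩ := h1
    have h2 : (Q h - c) • v + (-B) • h = 0 := by rw [sub_smul, hc, hv']; abel
    have h3 := hQc (Q h - c) (-B)
    have h4 := hBc (Q h - c) (-B)
    rw [h2, QuadraticMap.map_zero] at h3
    rw [h2, QuadraticMap.polar_zero_left] at h4
    have h5 : B * B * Q h = 0 := by linear_combination B * h4 + h3
    exact mul_ne_zero (mul_ne_zero hB hB) hh h5
  · simp only [Projectivization.submodule_mk, Submodule.span_singleton_le_iff_mem, hpv, hs]
    rw [hv', add_comm]
    exact Submodule.add_mem_sup (Submodule.smul_mem _ _ (Submodule.mem_span_singleton_self _))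
      (Submodule.smul_mem _ _ (Submodule.mem_span_singleton_self _))
  · rintro ⟨⟨w, hw⟩, hwH⟩ ⟨hne, hle⟩
    apply Subtype.ext
    apply Subtype.ext
    apply Projectivization.submodule_injective
    simp only [Projectivization.submodule_mk]
    have hwv := w.submodule_eq
    have hw0 := w.rep_nonzero
    set u := w.rep
    simp only [hwv, Submodule.span_singleton_le_iff_mem, hs, hpv] at hle
    obtain ⟨x, hx, y, hy, hxy⟩ := Submodule.mem_sup.1 hle
    obtain ⟨b, rfl⟩ := Submodule.mem_span_singleton.1 hx
    obtain ⟨a, rfl⟩ := Submodule.mem_span_singleton.1 hy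
    rw [add_comm] at hxy
    have hQu : Q u = 0 := hw u (by rw [hwv]; exact Submodule.mem_span_singleton_self u)
    rw [← hxy, hQc] at hQu
    have hb : b ≠ 0 := by
      rintro rfl
      apply hne
      apply Subtype.ext
      apply Subtype.ext
      apply Projectivization.submodule_injective
      simp only [hwv, hpv]
      rw [zero_smul, add_zero] at hxy
      have ha : a ≠ 0 := by
        rintro rfl
        exact hw0 (by rw [← hxy, zero_smul])
      rw [← hxy]
      exact Submodule.span_singleton_smul_eq (IsUnit.mk0 a ha) v
    have hab : a * B = - (b * Q h) := by
      apply mul_left_cancel₀ hb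
      linear_combination hQu
    have ha : a ≠ 0 := by
      rintro rfl
      rw [zero_mul, eq_comm, neg_eq_zero] at hab
      exact mul_ne_zero hb hh hab
    have huv : Q h • u = a • v' := by
      rw [← hxy, hv', smul_add, smul_add, smul_smul, smul_smul, smul_smul, smul_smul, mul_neg, hab,
        neg_neg, mul_comm a, mul_comm b]
    rw [hwv, ← Submodule.span_singleton_smul_eq (IsUnit.mk0 _ hh) u, huv]
    exact Submodule.span_singleton_smul_eq (IsUnit.mk0 a ha) v'

/-- The involution `σ` on `X`: `σ p` is the second point of the quadric on the line joining the
pole of `H` to `p`. -/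
noncomputable def conjugatePoint (hQ : IsEllipticQuadric Q) (hH : IsParabolicHyperplane Q H)
    (p : OffPoint Q H) : OffPoint Q H :=
  (existsUnique_conj hQ hH p).choose

/-- A point collinear to `v` is never collinear to `σ v`. -/
theorem not_adj_conjugatePoint (hQ : IsEllipticQuadric Q) (hH : IsParabolicHyperplane Q H)
    {u v : OffPoint Q H} (huv : (collinearityGraph Q).Adj u.1 v.1) :
    ¬ (collinearityGraph Q).Adj u.1 (conjugatePoint hQ hH v).1 := by
  intro huv'
  obtain ⟨hne, hle⟩ : conjugatePoint hQ hH v ≠ v ∧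
      (conjugatePoint hQ hH v).1.1.submodule ≤ perp Q H ⊔ v.1.1.submodule :=
    (existsUnique_conj hQ hH v).choose_spec.1
  set v' := conjugatePoint hQ hH v
  obtain ⟨h, hs, hh, hmem⟩ := exists_pole hQ hH
  have hwv := v'.1.1.submodule_eq
  have hw0 := v'.1.1.rep_nonzero
  have hpv := v.1.1.submodule_eq
  set w := v'.1.1.rep
  have hwm : w ∈ v'.1.1.submodule := by rw [hwv]; exact Submodule.mem_span_singleton_self w
  obtain ⟨x, hx, y, hy, hxy⟩ := Submodule.mem_sup.1 (hle hwm)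
  rw [hs] at hx
  obtain ⟨b, rfl⟩ := Submodule.mem_span_singleton.1 hx
  have hb : b ≠ 0 := by
    rintro rfl
    apply hne
    apply Subtype.ext
    apply Subtype.ext
    apply Projectivization.submodule_injective
    rw [zero_smul, zero_add] at hxy
    rw [hpv] at hy
    obtain ⟨a, rfl⟩ := Submodule.mem_span_singleton.1 hy
    have ha : a ≠ 0 := by
      rintro rfl
      exact hw0 (by rw [← hxy, zero_smul])
    rw [hwv, hpv, ← hxy]
    exact Submodule.span_singleton_smul_eq (IsUnit.mk0 a ha) _
  apply u.2
  intro z hz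
  have h1 : QuadraticMap.polar Q z w = 0 := huv'.2 hwm z hz
  have h2 : QuadraticMap.polar Q z y = 0 := huv.2 hy z hz
  rw [← hxy, QuadraticMap.polar_add_right, QuadraticMap.polar_smul_right, h2, add_zero,
    smul_eq_mul] at h1
  exact (hmem z).1 ((mul_eq_zero.1 h1).resolve_left hb)

/-- The graph `(X, R₃)`: `u` and `v` are adjacent if `u` is collinear to `v` but not to `σ v`. -/
noncomputable def graphR3 (hQ : IsEllipticQuadric Q) (hH : IsParabolicHyperplane Q H) :
    SimpleGraph (OffPoint Q H) where
  Adj u v := (collinearityGraph Q).Adj u.1 v.1 ∧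
    ¬ (collinearityGraph Q).Adj u.1 (conjugatePoint hQ hH v).1
  symm := ⟨fun _ _ h => ⟨h.1.symm, not_adj_conjugatePoint hQ hH h.1.symm⟩⟩
  loopless := ⟨fun _ h => h.1.1 rfl⟩

end Conjugation

end Quadric

/-! The points of $\mathsf{Q}^-(5,q)$ with its lines form a generalized quadrangle of order
$(q,q^2)$. If $b=A+I$ for the collinearity matrix $A$, then $b^2=(q-q^2)b+q^3I+(q^2+1)J$
(`IsEllipticQuadric.sum_perpMatrix_mul_perpMatrix_eq`), so on zero-sum vectors the eigenvalues of
$b$ are $q$ and $-q^2$. The relation $R_3$ is just collinearity restricted to $X$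
(`graphR3_adj_iff`).

Write $\chi_Y=c\,\chi_X+w$, where $w$ is the given eigenvector extended by zero. On $X$ we have
$bw=qw$, and $w$ has zero sum because $X$ induces a regular graph of a different eigenvalue. The
quadratic relation then gives $\|bw\|^2=w^{\mathsf T}b^2w=q^2\|w\|^2$. The coordinates in $X$
already account for this norm, so $bw$ vanishes off $X$, and $w$ is an eigenvector of the whole
quadric (`eigenvector_of_eigenvector_on`).

A point sees $q^3-q^2+q$ points of $X$ (itself included) if it lies in $X$, and $q^3-q^2$ if it lies
in $H$. The excess $q$ is absorbed by $q\chi_Y$, so $A\chi_Y=(q-1)\chi_Y+cq^2(q-1)j$. From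
$|Y|=c|X|=cq^2(q^2-1)$ the constant is $|Y|/(q+1)$, which gives both claims (`ncard_collinear_eq`).
The point counts come from splitting off hyperbolic planes, uniformly in the characteristic. -/

section SingularVectors

/-! ### Hyperbolic pairs and the splitting of singular vectors -/

variable {K V : Type*} [Field K] [AddCommGroup V] [Module K V]

/-- The vectors perpendicular to `a` with respect to the polar form of `Q`. -/
def orth (Q : QuadraticForm K V) (a : V) : Submodule K V := LinearMap.ker (Q.polarBilin a)

theorem mem_orth {Q : QuadraticForm K V} {a v : V} :
    v ∈ orth Q a ↔ QuadraticMap.polar Q a v = 0 := by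
  simp [orth]

/-- The number of singular vectors of `W`. -/
noncomputable def singularCount (Q : QuadraticForm K V) (W : Submodule K V) : ℕ :=
  Nat.card {v : W // Q v = 0}

/-- No nonzero singular vector of `W` is perpendicular to `W`. -/
def IsNonsingularOn (Q : QuadraticForm K V) (W : Submodule K V) : Prop :=
  ∀ w ∈ W, Q w = 0 → (∀ v ∈ W, QuadraticMap.polar Q w v = 0) → w = 0

variable {Q : QuadraticForm K V} {W : Submodule K V} {a b : V}

theorem polar_self_of_singular (h : Q a = 0) : QuadraticMap.polar Q a a = 0 := by
  rw [QuadraticMap.polar_self, h, smul_zero]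

theorem map_smul_add_smul_add {w : V} (hQa : Q a = 0) (hQb : Q b = 0)
    (hab : QuadraticMap.polar Q a b = 1) (haw : QuadraticMap.polar Q a w = 0)
    (hbw : QuadraticMap.polar Q b w = 0) (s t : K) : Q (s • a + t • b + w) = s * t + Q w := by
  rw [QuadraticMap.map_add Q, QuadraticMap.map_add Q, QuadraticMap.polar_add_left,
    QuadraticMap.map_smul, QuadraticMap.map_smul, QuadraticMap.polar_smul_left,
    QuadraticMap.polar_smul_left, QuadraticMap.polar_smul_left, QuadraticMap.polar_smul_right,
    hQa, hQb, hab, haw, hbw]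
  simp

/-- A subspace containing a hyperbolic pair splits off the hyperbolic plane it spans. -/
def hyperbolicSplitting (ha : a ∈ W) (hb : b ∈ W) (hQa : Q a = 0) (hQb : Q b = 0)
    (hab : QuadraticMap.polar Q a b = 1) :
    (K × K × (W ⊓ orth Q a ⊓ orth Q b : Submodule K V)) ≃ W where
  toFun x := ⟨x.1 • a + x.2.1 • b + x.2.2, W.add_mem (W.add_mem (W.smul_mem _ ha)
    (W.smul_mem _ hb)) x.2.2.2.1.1⟩
  -- In a hyperbolic pair, pairing with `b` reads off the coefficient of `a`, and conversely.
  invFun v := ⟨QuadraticMap.polar Q b v, QuadraticMap.polar Q a v,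
    ⟨v - (QuadraticMap.polar Q b v • a + QuadraticMap.polar Q a v • b), by
      have hba : QuadraticMap.polar Q b a = 1 := by rw [QuadraticMap.polar_comm, hab]
      refine ⟨⟨W.sub_mem v.2 (W.add_mem (W.smul_mem _ ha) (W.smul_mem _ hb)), ?_⟩, ?_⟩
      · refine mem_orth.2 ?_
        rw [QuadraticMap.polar_sub_right, QuadraticMap.polar_add_right,
          QuadraticMap.polar_smul_right, QuadraticMap.polar_smul_right,
          polar_self_of_singular hQa, hab]
        simp
      · refine mem_orth.2 ?_
        rw [QuadraticMap.polar_sub_right, QuadraticMap.polar_add_right,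
          QuadraticMap.polar_smul_right, QuadraticMap.polar_smul_right,
          polar_self_of_singular hQb, hba]
        simp⟩⟩
  left_inv := by
    rintro ⟨s, t, w, ⟨hw, haw⟩, hbw⟩
    have haw := mem_orth.1 haw
    have hbw := mem_orth.1 hbw
    have hba : QuadraticMap.polar Q b a = 1 := by rw [QuadraticMap.polar_comm, hab]
    have h1 : QuadraticMap.polar Q b (s • a + t • b + w) = s := by
      rw [QuadraticMap.polar_add_right, QuadraticMap.polar_add_right,
          QuadraticMap.polar_smul_right, QuadraticMap.polar_smul_right,
          polar_self_of_singular hQb, hba, hbw]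
      simp
    have h2 : QuadraticMap.polar Q a (s • a + t • b + w) = t := by
      rw [QuadraticMap.polar_add_right, QuadraticMap.polar_add_right,
          QuadraticMap.polar_smul_right, QuadraticMap.polar_smul_right,
          polar_self_of_singular hQa, hab, haw]
      simp
    simp only [h1, h2, Prod.mk.injEq, true_and]
    apply Subtype.ext
    simp
  right_inv := by
    rintro ⟨v, hv⟩
    apply Subtype.ext
    simp

theorem IsNonsingularOn.inf_orth (hW : IsNonsingularOn Q W) (ha : a ∈ W) (hb : b ∈ W)
    (hQa : Q a = 0) (hQb : Q b = 0) (hab : QuadraticMap.polar Q a b = 1) :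
    IsNonsingularOn Q (W ⊓ orth Q a ⊓ orth Q b) := by
  rintro w ⟨⟨hw, haw⟩, hbw⟩ hQw h
  refine hW w hw hQw fun v hv => ?_
  have haw := mem_orth.1 haw
  have hbw := mem_orth.1 hbw
  obtain ⟨⟨s, t, u⟩, hu⟩ := (hyperbolicSplitting ha hb hQa hQb hab).surjective ⟨v, hv⟩
  have hu : s • a + t • b + (u : V) = v := congrArg Subtype.val hu
  rw [← hu, QuadraticMap.polar_add_right, QuadraticMap.polar_add_right,
    QuadraticMap.polar_smul_right, QuadraticMap.polar_smul_right, h u u.2,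
    QuadraticMap.polar_comm, haw, QuadraticMap.polar_comm, hbw]
  simp

/-- A singular vector not perpendicular to `W` is part of a hyperbolic pair. -/
theorem exists_hyperbolic_partner (ha : a ∈ W) (hQa : Q a = 0) (hb : b ∈ W)
    (hab : QuadraticMap.polar Q a b ≠ 0) :
    ∃ c ∈ W, Q c = 0 ∧ QuadraticMap.polar Q a c = 1 := by
  set B := QuadraticMap.polar Q a b with hB
  -- After scaling `b` to pair to $1$ with `a`, adding $t\,a$ changes the value of `Q` by exactly
  -- $t$; this $t$ cancels $B^{-2}Q(b)$.
  refine ⟨B⁻¹ • b + (-(B⁻¹ * B⁻¹ * Q b)) • a, W.add_mem (W.smul_mem _ hb) (W.smul_mem _ ha), ?_, ?_⟩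
  · rw [QuadraticMap.map_add Q, QuadraticMap.map_smul, QuadraticMap.map_smul,
      QuadraticMap.polar_smul_left, QuadraticMap.polar_smul_right, QuadraticMap.polar_comm, ← hB,
      hQa]
    simp only [smul_eq_mul]
    field_simp
    ring
  · rw [QuadraticMap.polar_add_right, QuadraticMap.polar_smul_right,
      QuadraticMap.polar_smul_right, polar_self_of_singular hQa, ← hB]
    simp [hab]

theorem IsNonsingularOn.exists_partner (hW : IsNonsingularOn Q W) (ha : a ∈ W) (ha0 : a ≠ 0)
    (hQa : Q a = 0) : ∃ c ∈ W, Q c = 0 ∧ QuadraticMap.polar Q a c = 1 := by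
  by_contra hcon
  refine ha0 (hW a ha hQa fun v hv => ?_)
  by_contra hne
  exact hcon (exists_hyperbolic_partner ha hQa hv hne)

theorem singularCount_eq_one (h : ∀ w ∈ W, Q w = 0 → w = 0) : singularCount Q W = 1 := by
  rw [singularCount, Nat.card_eq_one_iff_exists]
  exact ⟨⟨0, by simp⟩, fun v => Subtype.ext (Subtype.ext (h v.1 v.1.2 v.2))⟩

/-- Adding a perpendicular singular vector multiplies the number of singular vectors by `q`. -/
theorem singularCount_inf_orth_left [Fintype K] (ha : a ∈ W) (hQa : Q a = 0)
    (hab : QuadraticMap.polar Q a b = 1) :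
    singularCount Q (W ⊓ orth Q a) =
      Fintype.card K * singularCount Q (W ⊓ orth Q a ⊓ orth Q b) := by
  have haa := polar_self_of_singular hQa
  have hba : QuadraticMap.polar Q b a = 1 := by rw [QuadraticMap.polar_comm, hab]
  have hval : ∀ (s : K) (w : V), w ∈ orth Q a → Q (s • a + w) = Q w := by
    intro s w hw
    rw [QuadraticMap.map_add Q, QuadraticMap.map_smul, QuadraticMap.polar_smul_left, hQa,
      mem_orth.1 hw]
    simp
  rw [singularCount, singularCount, ← Nat.card_eq_fintype_card, ← Nat.card_prod]
  -- Translation along `a` does not change `Q` on the perp of `a`, so each vector is moved to the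
  -- unique translate perpendicular to `b`.
  refine Nat.card_congr
    ⟨fun v => ⟨QuadraticMap.polar Q b v.1, ⟨⟨(-QuadraticMap.polar Q b v.1) • a + v.1, ?_⟩, ?_⟩⟩,
      fun x => ⟨⟨x.1 • a + x.2.1, ?_⟩, ?_⟩, ?_, ?_⟩
  · refine ⟨Submodule.add_mem _ (Submodule.smul_mem _ _ ⟨ha, mem_orth.2 haa⟩) v.1.2, ?_⟩
    refine mem_orth.2 ?_
    rw [QuadraticMap.polar_add_right, QuadraticMap.polar_smul_right, hba]
    simp
  · rw [hval _ _ v.1.2.2]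
    exact v.2
  · exact Submodule.add_mem _ (Submodule.smul_mem _ _ ⟨ha, mem_orth.2 haa⟩) x.2.1.2.1
  · rw [hval _ _ x.2.1.2.1.2]
    exact x.2.2
  · intro v
    apply Subtype.ext
    apply Subtype.ext
    simp
  · rintro ⟨s, ⟨w, hw⟩, hQw⟩
    have : QuadraticMap.polar Q b (s • a + w) = s := by
      rw [QuadraticMap.polar_add_right, QuadraticMap.polar_smul_right, hba, mem_orth.1 hw.2]
      simp
    simp only [this, Prod.mk.injEq, true_and]
    apply Subtype.ext
    apply Subtype.ext
    simp

/-! ### Counting singular vectors over a finite field -/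

section Finite

variable [Fintype K] [Finite V]

theorem natCard_submodule (W : Submodule K V) :
    Nat.card W = Fintype.card K ^ Module.finrank K W := by
  have := Fintype.ofFinite W
  rw [Nat.card_eq_fintype_card, Module.card_eq_pow_finrank (K := K)]

theorem finrank_inf_orth (ha : a ∈ W) (hb : b ∈ W) (hQa : Q a = 0) (hQb : Q b = 0)
    (hab : QuadraticMap.polar Q a b = 1) :
    Module.finrank K W = Module.finrank K (W ⊓ orth Q a ⊓ orth Q b : Submodule K V) + 2 := by
  have h := Nat.card_congr (hyperbolicSplitting ha hb hQa hQb hab)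
  rw [Nat.card_prod, Nat.card_prod, natCard_submodule, natCard_submodule, Nat.card_eq_fintype_card]
    at h
  apply Nat.pow_right_injective (Fintype.one_lt_card (α := K))
  simp only [← h]
  ring

theorem natCard_mul_add_eq_zero (d : K) [DecidableEq K] :
    Nat.card {x : K × K // x.1 * x.2 + d = 0} =
      if d = 0 then 2 * Fintype.card K - 1 else Fintype.card K - 1 := by
  have hq := Fintype.one_lt_card (α := K)
  have hsum : Nat.card {x : K × K // x.1 * x.2 + d = 0} =
      ∑ s : K, Nat.card {t : K // s * t + d = 0} := by
    rw [← Nat.card_sigma]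
    exact Nat.card_congr
      ⟨fun x => ⟨x.1.1, x.1.2, x.2⟩, fun x => ⟨(x.1, x.2.1), x.2.2⟩, fun _ => rfl, fun _ => rfl⟩
  have hne : ∀ s : K, s ≠ 0 → Nat.card {t : K // s * t + d = 0} = 1 := by
    intro s hs
    rw [Nat.card_eq_one_iff_exists]
    refine ⟨⟨-(d / s), by field_simp; ring⟩, ?_⟩
    rintro ⟨t, ht⟩
    apply Subtype.ext
    field_simp
    linear_combination ht
  rw [hsum, ← Finset.add_sum_erase _ _ (Finset.mem_univ (0 : K)),
    Finset.sum_congr rfl fun s hs => hne s (Finset.ne_of_mem_erase hs)]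
  have hzero : Nat.card {t : K // (0 : K) * t + d = 0} = if d = 0 then Fintype.card K else 0 := by
    split_ifs with hd
    · simp [hd, Nat.card_eq_fintype_card]
    · simp [hd]
  rw [hzero]
  simp only [Finset.sum_const, Finset.card_erase_of_mem (Finset.mem_univ _), Finset.card_univ]
  split_ifs
  · simp
    omega
  · simp

/-- Over each $u$ in the complement, $st=-Q(u)$ has $2q-1$ solutions if $u$ is singular and $q-1$
otherwise, that is, $q\cdot[Q(u)=0]+(q-1)$. -/
theorem singularCount_inf_orth (ha : a ∈ W) (hb : b ∈ W) (hQa : Q a = 0) (hQb : Q b = 0)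
    (hab : QuadraticMap.polar Q a b = 1) :
    (singularCount Q W : ℤ) =
      Fintype.card K * singularCount Q (W ⊓ orth Q a ⊓ orth Q b) +
        (Fintype.card K - 1) * Fintype.card K ^
          Module.finrank K (W ⊓ orth Q a ⊓ orth Q b : Submodule K V) := by
  classical
  rw [← Nat.cast_pow, ← natCard_submodule]
  set U : Submodule K V := W ⊓ orth Q a ⊓ orth Q b with hU
  have := Fintype.ofFinite U
  have hval : ∀ x : K × K × U, Q (hyperbolicSplitting ha hb hQa hQb hab x) =
      x.1 * x.2.1 + Q x.2.2 := fun x =>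
    map_smul_add_smul_add hQa hQb hab (mem_orth.1 x.2.2.2.1.2) (mem_orth.1 x.2.2.2.2) _ _
  have e1 : singularCount Q W = Nat.card {x : K × K × U // x.1 * x.2.1 + Q x.2.2 = 0} := by
    refine (Nat.card_congr ((hyperbolicSplitting ha hb hQa hQb hab).subtypeEquiv fun x => ?_)).symm
    rw [hval]
  have e2 : Nat.card {x : K × K × U // x.1 * x.2.1 + Q x.2.2 = 0} =
      ∑ u : U, Nat.card {x : K × K // x.1 * x.2 + Q u = 0} := by
    rw [← Nat.card_sigma]
    exact Nat.card_congr ⟨fun x => ⟨x.1.2.2, (x.1.1, x.1.2.1), x.2⟩,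
      fun x => ⟨(x.2.1.1, x.2.1.2, x.1), x.2.2⟩, fun _ => rfl, fun _ => rfl⟩
  have hq := Fintype.one_lt_card (α := K)
  have e3 : ∀ u : U, ((Nat.card {x : K × K // x.1 * x.2 + Q u = 0} : ℕ) : ℤ) =
      (Fintype.card K : ℤ) * (if Q u = 0 then 1 else 0) + ((Fintype.card K : ℤ) - 1) := by
    intro u
    rw [natCard_mul_add_eq_zero]
    split_ifs <;> push_cast [Nat.cast_sub (show 1 ≤ 2 * Fintype.card K by omega),
      Nat.cast_sub hq.le] <;> ring
  rw [e1, e2, Nat.cast_sum, Finset.sum_congr rfl fun u _ => e3 u, Finset.sum_add_distrib,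
    ← Finset.mul_sum, Finset.sum_boole, singularCount, Nat.card_eq_fintype_card,
    Fintype.card_subtype, Nat.card_eq_fintype_card]
  simp only [Finset.sum_const, Finset.card_univ, nsmul_eq_mul]
  ring

/-- A quadratic form in at least three variables over a finite field is isotropic. -/
theorem exists_singular_of_three_le (hW : 3 ≤ Module.finrank K W) :
    ∃ w ∈ W, w ≠ 0 ∧ Q w = 0 := by
  classical
  -- The bilinear form need not be symmetric, so it exists in characteristic $2$ as well.
  obtain ⟨B, hB⟩ := LinearMap.BilinMap.toQuadraticMap_surjective (Q.restrict W)
  set e := Module.finBasis K W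
  set f : MvPolynomial (Fin (Module.finrank K W)) K :=
    ∑ i, ∑ j, MvPolynomial.C (B (e i) (e j)) * (MvPolynomial.X i * MvPolynomial.X j) with hf
  have hdeg : f.totalDegree < Fintype.card (Fin (Module.finrank K W)) := by
    rw [Fintype.card_fin]
    refine lt_of_le_of_lt (b := 2) ?_ (by omega)
    refine MvPolynomial.totalDegree_finsetSum_le fun i _ =>
      MvPolynomial.totalDegree_finsetSum_le fun j _ => ?_
    refine (MvPolynomial.totalDegree_mul _ _).trans ?_
    refine (add_le_add le_rfl (MvPolynomial.totalDegree_mul _ _)).trans ?_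
    simp
  have heval : ∀ x, MvPolynomial.eval x f = Q (∑ i, x i • e i : W) := by
    intro x
    have : Q (∑ i, x i • e i : W) = (Q.restrict W) (∑ i, x i • e i) := rfl
    rw [this, ← hB, LinearMap.BilinMap.toQuadraticMap_apply]
    simp only [hf, map_sum, map_mul, MvPolynomial.eval_C, MvPolynomial.eval_X, map_smul,
      LinearMap.sum_apply, LinearMap.smul_apply, smul_eq_mul, Finset.mul_sum]
    rw [Finset.sum_comm]
    refine Finset.sum_congr rfl fun i _ => Finset.sum_congr rfl fun j _ => ?_
    ring
  obtain ⟨p, hp⟩ := CharP.exists K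
  have hprime : p.Prime := (CharP.char_is_prime K p)
  -- Chevalley–Warning: the characteristic divides the number of zeros, and the trivial zero is one
  -- of them, so there is another.
  have hdvd := char_dvd_card_solutions p hdeg
  have hone : 1 < Fintype.card {x // MvPolynomial.eval x f = 0} :=
    lt_of_lt_of_le hprime.one_lt (Nat.le_of_dvd
      (Fintype.card_pos_iff.2 ⟨⟨0, by rw [heval]; simp⟩⟩) hdvd)
  obtain ⟨x, hx⟩ := Fintype.exists_ne_of_one_lt_card hone ⟨0, by rw [heval]; simp⟩
  refine ⟨(∑ i, x.1 i • e i : W), Subtype.prop _, fun h0 => hx ?_, by rw [← heval]; exact x.2⟩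
  apply Subtype.ext
  funext i
  exact Fintype.linearIndependent_iff.1 e.linearIndependent x.1 (Subtype.ext h0) i

/-- The number of singular vectors of a parabolic quadric. -/
theorem IsNonsingularOn.singularCount_odd (n : ℕ) : ∀ {W : Submodule K V}, IsNonsingularOn Q W →
    Module.finrank K W = 2 * n + 1 → (singularCount Q W : ℤ) = Fintype.card K ^ (2 * n) := by
  induction n with
  | zero =>
    intro W hW hr
    rw [singularCount_eq_one, mul_zero, pow_zero, Nat.cast_one]
    intro w hw hQw
    by_contra hw0
    refine hw0 (hW w hw hQw fun v hv => ?_)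
    obtain ⟨c, hc⟩ := (finrank_eq_one_iff_of_nonzero' (⟨w, hw⟩ : W)
      (fun h => hw0 (congrArg Subtype.val h))).1 hr ⟨v, hv⟩
    have hc : c • w = v := congrArg Subtype.val hc
    rw [← hc, QuadraticMap.polar_smul_right, polar_self_of_singular hQw, smul_zero]
  | succ n ih =>
    intro W hW hr
    obtain ⟨a, ha, ha0, hQa⟩ := exists_singular_of_three_le (Q := Q) (W := W) (by omega)
    obtain ⟨b, hb, hQb, hab⟩ := hW.exists_partner ha ha0 hQa
    have hr' := finrank_inf_orth ha hb hQa hQb hab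
    have hr'' : Module.finrank K (W ⊓ orth Q a ⊓ orth Q b : Submodule K V) = 2 * n + 1 := by omega
    -- The recursion is $q\cdot q^{2n}+(q-1)q^{2n+1}=q^{2n+2}$.
    rw [singularCount_inf_orth ha hb hQa hQb hab, ih (hW.inf_orth ha hb hQa hQb hab) hr'', hr'']
    ring

end Finite

end SingularVectors

/-! ### Singular vectors in the perps of points of the elliptic quadric -/

section EllipticQuadric

variable {K V : Type*} [Field K] [AddCommGroup V] [Module K V] {Q : QuadraticForm K V} {a b : V}

theorem IsEllipticQuadric.isNonsingularOn_top (hQ : IsEllipticQuadric Q) :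
    IsNonsingularOn Q ⊤ := fun w _ _ h =>
  hQ.polar_nondegenerate.1 w fun v => by simpa using h v trivial

/-- In characteristic $2$ the polar form on `H` has a nonzero radical, the nucleus; only singular
vectors of that radical are excluded, and this is all that the counting needs. -/
theorem IsParabolicHyperplane.isNonsingularOn {H : Submodule K V}
    (hH : IsParabolicHyperplane Q H) : IsNonsingularOn Q H := by
  intro w hw hQw h
  have hr : (⟨w, hw⟩ : H) ∈ (Q.restrict H).radical := by
    refine ⟨by simpa using hQw, ?_⟩
    ext n
    simpa [QuadraticMap.polar] using h n n.2
  rw [hH.nondegenerate.radical_eq_bot] at hr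
  exact congrArg Subtype.val ((Submodule.mem_bot K).1 hr)

theorem map_mem_span_triple {a b c v : V} (hQa : Q a = 0) (hQb : Q b = 0) (hQc : Q c = 0)
    (hab : QuadraticMap.polar Q a b = 0) (hac : QuadraticMap.polar Q a c = 0)
    (hbc : QuadraticMap.polar Q b c = 0) (hv : v ∈ Submodule.span K {a, b, c}) : Q v = 0 := by
  obtain ⟨r, s, t, rfl⟩ := Submodule.mem_span_triple.1 hv
  rw [QuadraticMap.map_add Q, QuadraticMap.map_add Q]
  simp only [QuadraticMap.polar_add_left, QuadraticMap.map_smul, QuadraticMap.polar_smul_left,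
    QuadraticMap.polar_smul_right, hQa, hQb, hQc, hab, hac, hbc]
  simp

/-- Lines are maximal totally singular subspaces of an elliptic quadric. -/
theorem IsEllipticQuadric.mem_span_pair (hQ : IsEllipticQuadric Q) {c : V}
    (hli : LinearIndependent K ![a, b]) (hQa : Q a = 0) (hQb : Q b = 0) (hQc : Q c = 0)
    (hab : QuadraticMap.polar Q a b = 0) (hac : QuadraticMap.polar Q a c = 0)
    (hbc : QuadraticMap.polar Q b c = 0) : c ∈ Submodule.span K {a, b} := by
  by_contra hc
  have h3 : LinearIndependent K ![c, a, b] := by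
    refine linearIndependent_finCons.2 ⟨hli, ?_⟩
    rwa [Matrix.range_cons_cons_empty]
  refine hQ.not_exists_plane ⟨Submodule.span K {c, a, b}, ?_, fun w hw => ?_⟩
  · have := finrank_span_eq_card h3
    rwa [Matrix.range_cons, Matrix.range_cons_cons_empty, Fintype.card_fin] at this
  · exact map_mem_span_triple hQc hQa hQb (by rw [QuadraticMap.polar_comm, hac])
      (by rw [QuadraticMap.polar_comm, hbc]) hab hw

theorem orth_smul {c : K} (hc : c ≠ 0) : orth Q (c • a) = orth Q a := by
  ext v
  simp [mem_orth, QuadraticMap.polar_smul_left, hc]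

variable [Fintype K] [Finite V]

/-- A second hyperbolic pair $c,d$ splits off, and the remaining plane is anisotropic: a singular
vector in it is perpendicular to the line $\langle a,c\rangle$, hence lies on it by maximality, and
pairing with $b$ and $d$ kills it. The count is $q\cdot 1+(q-1)q^2$. -/
theorem IsEllipticQuadric.singularCount_orth_pair (hQ : IsEllipticQuadric Q) (hQa : Q a = 0)
    (hQb : Q b = 0) (hab : QuadraticMap.polar Q a b = 1) :
    Module.finrank K (⊤ ⊓ orth Q a ⊓ orth Q b : Submodule K V) = 4 ∧
    (singularCount Q (⊤ ⊓ orth Q a ⊓ orth Q b) : ℤ) =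
      Fintype.card K ^ 3 - Fintype.card K ^ 2 + Fintype.card K := by
  have hr := finrank_inf_orth (W := ⊤) (Q := Q) trivial trivial hQa hQb hab
  rw [finrank_top, hQ.finrank_eq] at hr
  have hns := hQ.isNonsingularOn_top.inf_orth trivial trivial hQa hQb hab
  refine ⟨by omega, ?_⟩
  obtain ⟨c, hc, hc0, hQc⟩ := exists_singular_of_three_le (Q := Q)
    (W := (⊤ ⊓ orth Q a ⊓ orth Q b : Submodule K V)) (by omega)
  obtain ⟨d, hd, hQd, hcd⟩ := hns.exists_partner hc hc0 hQc
  have hr' := finrank_inf_orth hc hd hQc hQd hcd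
  have hac := mem_orth.1 hc.1.2
  have hbc := mem_orth.1 hc.2
  have hbd := mem_orth.1 hd.2
  have had := mem_orth.1 hd.1.2
  have hba : QuadraticMap.polar Q b a = 1 := by rw [QuadraticMap.polar_comm, hab]
  have hdc : QuadraticMap.polar Q d c = 1 := by rw [QuadraticMap.polar_comm, hcd]
  have hda : QuadraticMap.polar Q d a = 0 := by rw [QuadraticMap.polar_comm, had]
  have hli : LinearIndependent K ![a, c] := by
    rw [LinearIndependent.pair_iff]
    intro s t hst
    have h1 := congrArg (QuadraticMap.polar Q b) hst
    have h2 := congrArg (QuadraticMap.polar Q d) hst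
    simp only [QuadraticMap.polar_add_right, QuadraticMap.polar_smul_right, hba, hbc, hda, hdc,
      QuadraticMap.polar_zero_right] at h1 h2
    simpa using And.intro h1 h2
  rw [singularCount_inf_orth hc hd hQc hQd hcd, singularCount_eq_one,
    show Module.finrank K (⊤ ⊓ orth Q a ⊓ orth Q b ⊓ orth Q c ⊓ orth Q d : Submodule K V) = 2
      by omega]
  · push_cast
    ring
  · rintro w ⟨⟨⟨⟨-, haw⟩, hbw⟩, hcw⟩, hdw⟩ hQw
    have hw := hQ.mem_span_pair hli hQa hQc hQw hac (mem_orth.1 haw) (mem_orth.1 hcw)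
    obtain ⟨s, t, rfl⟩ := Submodule.mem_span_pair.1 hw
    have h1 := mem_orth.1 hbw
    have h2 := mem_orth.1 hdw
    simp only [QuadraticMap.polar_add_right, QuadraticMap.polar_smul_right, hba, hbc, hda,
      hdc] at h1 h2
    simp only [smul_eq_mul, mul_one, mul_zero, add_zero, zero_add] at h1 h2
    simp [h1, h2]

theorem IsEllipticQuadric.singularCount_orth_inf_orth (hQ : IsEllipticQuadric Q) (hQa : Q a = 0)
    (hQb : Q b = 0) (hab : QuadraticMap.polar Q a b ≠ 0) :
    (singularCount Q (orth Q a ⊓ orth Q b) : ℤ) =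
      Fintype.card K ^ 3 - Fintype.card K ^ 2 + Fintype.card K := by
  have h := (hQ.singularCount_orth_pair (a := a) (b := (QuadraticMap.polar Q a b)⁻¹ • b) hQa
    (by rw [QuadraticMap.map_smul, hQb, smul_zero])
    (by rw [QuadraticMap.polar_smul_right, smul_eq_mul, inv_mul_cancel₀ hab])).2
  rwa [top_inf_eq, orth_smul (inv_ne_zero hab)] at h

theorem IsEllipticQuadric.singularCount_orth (hQ : IsEllipticQuadric Q) (ha0 : a ≠ 0)
    (hQa : Q a = 0) :
    (singularCount Q (orth Q a) : ℤ) =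
      Fintype.card K * (Fintype.card K ^ 3 - Fintype.card K ^ 2 + Fintype.card K) := by
  obtain ⟨b, -, hQb, hab⟩ := hQ.isNonsingularOn_top.exists_partner trivial ha0 hQa
  have h := singularCount_inf_orth_left (W := ⊤) (Q := Q) Submodule.mem_top hQa hab
  rw [← (hQ.singularCount_orth_pair hQa hQb hab).2, ← Nat.cast_mul, ← h, top_inf_eq]

theorem IsEllipticQuadric.singularCount_top (hQ : IsEllipticQuadric Q) (ha0 : a ≠ 0)
    (hQa : Q a = 0) :
    (singularCount Q (⊤ : Submodule K V) : ℤ) =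
      Fintype.card K * (Fintype.card K ^ 3 - Fintype.card K ^ 2 + Fintype.card K) +
        (Fintype.card K - 1) * Fintype.card K ^ 4 := by
  obtain ⟨b, -, hQb, hab⟩ := hQ.isNonsingularOn_top.exists_partner trivial ha0 hQa
  have h := hQ.singularCount_orth_pair hQa hQb hab
  rw [singularCount_inf_orth (W := ⊤) Submodule.mem_top Submodule.mem_top hQa hQb hab, h.1, h.2]

/-- As lines are maximal totally singular, the singular vectors perpendicular to both points are
exactly those of the line joining them. -/
theorem IsEllipticQuadric.singularCount_orth_inf_orth_of_collinear (hQ : IsEllipticQuadric Q)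
    (hQa : Q a = 0) (hQb : Q b = 0) (hab : QuadraticMap.polar Q a b = 0)
    (hli : LinearIndependent K ![a, b]) :
    singularCount Q (orth Q a ⊓ orth Q b) = Fintype.card K ^ 2 := by
  have hspan : Module.finrank K (Submodule.span K {a, b}) = 2 := by
    have := finrank_span_eq_card hli
    rwa [Matrix.range_cons_cons_empty, Fintype.card_fin] at this
  rw [← hspan, ← natCard_submodule, singularCount]
  have hmem : ∀ v : V, v ∈ Submodule.span K {a, b} ↔ v ∈ orth Q a ⊓ orth Q b ∧ Q v = 0 := by
    intro v
    constructor
    · intro hv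
      obtain ⟨s, t, rfl⟩ := Submodule.mem_span_pair.1 hv
      have hba : QuadraticMap.polar Q b a = 0 := by rw [QuadraticMap.polar_comm, hab]
      refine ⟨⟨mem_orth.2 ?_, mem_orth.2 ?_⟩, ?_⟩
      · simp [QuadraticMap.polar_add_right, QuadraticMap.polar_smul_right, hab,
          polar_self_of_singular hQa]
      · simp [QuadraticMap.polar_add_right, QuadraticMap.polar_smul_right, hba,
          polar_self_of_singular hQb]
      · rw [QuadraticMap.map_add Q]
        simp [QuadraticMap.map_smul, QuadraticMap.polar_smul_left,
          QuadraticMap.polar_smul_right, hQa, hQb, hab]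
    · rintro ⟨⟨h1, h2⟩, hQv⟩
      exact hQ.mem_span_pair hli hQa hQb hQv hab (mem_orth.1 h1) (mem_orth.1 h2)
  exact Nat.card_congr ⟨fun v => ⟨v.1.1, (hmem _).2 ⟨v.1.2, v.2⟩⟩,
    fun v => ⟨⟨v.1, ((hmem _).1 v.2).1⟩, ((hmem _).1 v.2).2⟩, fun _ => rfl, fun _ => rfl⟩

variable {H : Submodule K V}

/-- The vector $Q(h)a-Bh$ represents the conjugate point $a^\sigma$, which is singular and not
perpendicular to $a$. For $v\perp a$, being perpendicular to it means being perpendicular to the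
pole $h$, so $H\cap a^\perp=a^\perp\cap (a^{\sigma})^\perp$ and the count for non-collinear pairs
applies. -/
theorem IsEllipticQuadric.singularCount_inf_orth_of_notMem (hQ : IsEllipticQuadric Q)
    (hH : IsParabolicHyperplane Q H) (hQa : Q a = 0) (ha : a ∉ H) :
    (singularCount Q (H ⊓ orth Q a) : ℤ) =
      Fintype.card K ^ 3 - Fintype.card K ^ 2 + Fintype.card K := by
  obtain ⟨h, -, hh, hmem⟩ := exists_pole hQ hH
  set B := QuadraticMap.polar Q a h with hB
  have hB0 : B ≠ 0 := fun h0 => ha ((hmem a).1 h0)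
  have hpol : ∀ v, QuadraticMap.polar Q (Q h • a - B • h) v =
      Q h * QuadraticMap.polar Q a v - B * QuadraticMap.polar Q v h := by
    intro v
    rw [QuadraticMap.polar_sub_left, QuadraticMap.polar_smul_left, QuadraticMap.polar_smul_left,
      QuadraticMap.polar_comm Q h v]
    rfl
  rw [← hQ.singularCount_orth_inf_orth (a := a) (b := Q h • a - B • h) hQa]
  · congr 2
    ext v
    rw [Submodule.mem_inf, Submodule.mem_inf, mem_orth, mem_orth, hpol, ← hmem, and_comm]
    refine and_congr_right fun h0 => ?_
    simp [h0, hB0]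
  · rw [sub_eq_add_neg, ← neg_smul, QuadraticMap.map_add Q, QuadraticMap.map_smul,
      QuadraticMap.map_smul, QuadraticMap.polar_smul_left, QuadraticMap.polar_smul_right, hQa, ← hB]
    simp only [smul_eq_mul]
    ring
  · rw [QuadraticMap.polar_comm, hpol, polar_self_of_singular hQa, ← hB]
    simpa using hB0

theorem IsParabolicHyperplane.singularCount_inf_orth_of_mem (hH : IsParabolicHyperplane Q H)
    (hQa : Q a = 0) (ha0 : a ≠ 0) (ha : a ∈ H) :
    (singularCount Q (H ⊓ orth Q a) : ℤ) = Fintype.card K ^ 3 := by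
  obtain ⟨b, hb, hQb, hab⟩ := hH.isNonsingularOn.exists_partner ha ha0 hQa
  have hr := finrank_inf_orth ha hb hQa hQb hab
  rw [hH.finrank_eq] at hr
  rw [singularCount_inf_orth_left ha hQa hab, Nat.cast_mul,
    (hH.isNonsingularOn.inf_orth ha hb hQa hQb hab).singularCount_odd 1 (by omega)]
  ring

/-- The number of points of the quadric in `W`. -/
noncomputable def pointCount (Q : QuadraticForm K V) (W : Submodule K V) : ℕ :=
  Nat.card {p : QuadricPoint Q // p.1.submodule ≤ W}

/-- Each point carries $q-1$ nonzero vectors; the summand $1$ is the zero vector. -/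
theorem pointCount_mul_add_one (W : Submodule K V) :
    pointCount Q W * ((Fintype.card K : ℤ) - 1) + 1 = singularCount Q W := by
  classical
  have h1 : singularCount Q W = Nat.card {v : {v : W // Q v = 0} // (v.1 : V) ≠ 0} + 1 := by
    have e := Nat.card_congr (Equiv.sumCompl fun v : {v : W // Q v = 0} => (v.1 : V) ≠ 0)
    rw [Nat.card_sum] at e
    rw [singularCount, ← e]
    congr 1
    rw [Nat.card_eq_one_iff_exists]
    exact ⟨⟨⟨0, by simp⟩, by simp⟩, fun v => Subtype.ext (Subtype.ext (Subtype.ext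
      (by simpa using v.2)))⟩
  have h2 : Nat.card {v : {v : W // Q v = 0} // (v.1 : V) ≠ 0} =
      Nat.card (Σ p : {p : QuadricPoint Q // p.1.submodule ≤ W},
        {v : p.1.1.submodule // v ≠ 0}) := by
    refine Nat.card_congr (Equiv.ofBijective (fun v => ⟨⟨⟨Projectivization.mk K v.1.1 v.2, ?_⟩, ?_⟩,
      ⟨⟨v.1.1, ?_⟩, ?_⟩⟩) ⟨?_, ?_⟩)
    · intro w hw
      rw [Projectivization.submodule_mk] at hw
      obtain ⟨c, rfl⟩ := Submodule.mem_span_singleton.1 hw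
      rw [QuadraticMap.map_smul, v.1.2, smul_zero]
    · simp only [Projectivization.submodule_mk, Submodule.span_singleton_le_iff_mem]
      exact v.1.1.2
    · simp only [Projectivization.submodule_mk]
      exact Submodule.mem_span_singleton_self _
    · exact fun h => v.2 (congrArg Subtype.val h)
    · intro v w hvw
      apply Subtype.ext
      apply Subtype.ext
      apply Subtype.ext
      exact congrArg (fun x : (Σ p : {p : QuadricPoint Q // p.1.submodule ≤ W},
        {v : p.1.1.submodule // v ≠ 0}) => (x.2.1 : V)) hvw
    · rintro ⟨⟨⟨p, hp⟩, hpW⟩, ⟨⟨v, hv⟩, hv0⟩⟩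
      have hv0' : v ≠ 0 := fun h => hv0 (Subtype.ext h)
      have hpv : Projectivization.mk K v hv0' = p := by
        apply Projectivization.submodule_injective
        rw [Projectivization.submodule_mk]
        rw [p.submodule_eq] at hv ⊢
        obtain ⟨c, rfl⟩ := Submodule.mem_span_singleton.1 hv
        have hc : c ≠ 0 := by
          rintro rfl
          simp at hv0'
        exact Submodule.span_singleton_smul_eq (IsUnit.mk0 c hc) _
      subst hpv
      exact ⟨⟨⟨⟨v, hpW hv⟩, hp v hv⟩, hv0'⟩, rfl⟩
  have := Fintype.ofFinite {p : QuadricPoint Q // p.1.submodule ≤ W}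
  have h3 : ∀ p : {p : QuadricPoint Q // p.1.submodule ≤ W},
      Nat.card {v : p.1.1.submodule // v ≠ 0} = Fintype.card K - 1 := by
    intro p
    have := Fintype.ofFinite p.1.1.submodule
    rw [Nat.card_eq_fintype_card, Fintype.card_subtype_compl, Fintype.card_subtype_eq,
      ← Nat.card_eq_fintype_card, natCard_submodule, Projectivization.finrank_submodule, pow_one]
  rw [h1, h2, Nat.card_sigma, Finset.sum_congr rfl fun p _ => h3 p]
  simp only [Finset.sum_const, Finset.card_univ, smul_eq_mul]
  rw [pointCount, Nat.card_eq_fintype_card]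
  push_cast [Nat.cast_sub (Fintype.one_lt_card (α := K)).le]
  ring

theorem pointCount_eq {W : Submodule K V} {n : ℤ}
    (h : (singularCount Q W : ℤ) = n * ((Fintype.card K : ℤ) - 1) + 1) :
    (pointCount Q W : ℤ) = n := by
  have hq : ((Fintype.card K : ℤ) - 1) ≠ 0 := by
    have := Fintype.one_lt_card (α := K)
    omega
  rw [← pointCount_mul_add_one] at h
  exact mul_right_cancel₀ hq (by linarith)

end EllipticQuadric

/-! ### Extending an eigenvector from a subset by a norm computation -/

section Eigenvectors

/-- Let `w` be supported on `S`, with zero sum, and an eigenvector for `q` of the submatrix of the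
symmetric matrix `b` on `S`. If the rows of `b` indexed by `S` satisfy the quadratic relation of a
generalized quadrangle of order `(q, q ^ 2)`, then `w` is an eigenvector of `b`. -/
theorem eigenvector_of_eigenvector_on {α : Type*} [Fintype α] [DecidableEq α] {b : α → α → ℝ}
    (hsymm : ∀ x y, b x y = b y x) {S : Finset α} {q : ℝ} {w : α → ℝ} (hw : ∀ x, x ∉ S → w x = 0)
    (hb : ∀ x ∈ S, ∀ y ∈ S, ∑ z, b x z * b y z =
      (q - q ^ 2) * b x y + (if x = y then q ^ 3 else 0) + (q ^ 2 + 1))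
    (heig : ∀ x ∈ S, ∑ z, b x z * w z = q * w x) (hsum : ∑ x, w x = 0) (x : α) :
    ∑ z, b x z * w z = q * w x := by
  set g : α → ℝ := fun p => ∑ z, b p z * w z with hg
  have hterm : ∀ x y, w x * w y * ∑ z, b x z * b y z = w x * w y *
      ((q - q ^ 2) * b x y + (if x = y then q ^ 3 else 0) + (q ^ 2 + 1)) := by
    intro x y
    by_cases hx : x ∈ S
    · by_cases hy : y ∈ S
      · rw [hb x hx y hy]
      · simp [hw y hy]
    · simp [hw x hx]
  have hwg : ∀ x, w x * g x = q * w x ^ 2 := by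
    intro x
    by_cases hx : x ∈ S
    · rw [hg]
      simp only [heig x hx]
      ring
    · simp [hw x hx]
  -- This is $\|bw\|^2=w^{\mathsf T}b^2w$. The relation is needed only on `S`, where `w` lives; the
  -- constant term dies because `w` has zero sum, and $q(q-q^2)+q^3=q^2$.
  have hsq : ∑ p, g p ^ 2 = q ^ 2 * ∑ x, w x ^ 2 := by
    have e1 : ∀ p, g p ^ 2 = ∑ x, ∑ y, w x * w y * (b x p * b y p) := by
      intro p
      rw [sq, hg, Finset.sum_mul_sum]
      refine Finset.sum_congr rfl fun x _ => Finset.sum_congr rfl fun y _ => ?_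
      rw [hsymm p x, hsymm p y]
      ring
    have e2 : ∑ p, g p ^ 2 = ∑ x, ∑ y, w x * w y * ∑ z, b x z * b y z := by
      rw [Finset.sum_congr rfl fun p _ => e1 p, Finset.sum_comm]
      refine Finset.sum_congr rfl fun x _ => ?_
      rw [Finset.sum_comm]
      exact Finset.sum_congr rfl fun y _ => (Finset.mul_sum _ _ _).symm
    have e3 : ∀ x, ∑ y, w x * w y * ∑ z, b x z * b y z = q ^ 2 * w x ^ 2 := by
      intro x
      have : ∀ y, w x * w y * ∑ z, b x z * b y z = (q - q ^ 2) * w x * (b x y * w y) +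
          (if x = y then q ^ 3 * w x * w y else 0) + (q ^ 2 + 1) * w x * w y := by
        intro y
        rw [hterm]
        split_ifs <;> ring
      rw [Finset.sum_congr rfl fun y _ => this y, Finset.sum_add_distrib, Finset.sum_add_distrib,
        ← Finset.mul_sum, ← Finset.mul_sum, hsum, Finset.sum_ite_eq, if_pos (Finset.mem_univ _)]
      have := hwg x
      simp only [hg] at this
      linear_combination (q - q ^ 2) * this
    rw [e2, Finset.sum_congr rfl fun x _ => e3 x, ← Finset.mul_sum]
  -- The cross term is known pointwise from $w\,g=q\,w^2$, so the squared distance from $bw$ to $qw$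
  -- is $\|bw\|^2-q^2\|w\|^2=0$.
  have hzero : ∑ p, (g p - q * w p) ^ 2 = 0 := by
    have : ∀ p, (g p - q * w p) ^ 2 = g p ^ 2 - q ^ 2 * w p ^ 2 := fun p => by
      linear_combination (-2 * q) * hwg p
    rw [Finset.sum_congr rfl fun p _ => this p, Finset.sum_sub_distrib, hsq, Finset.mul_sum, sub_self]
  have := (Finset.sum_eq_zero_iff_of_nonneg fun p _ => sq_nonneg (g p - q * w p)).1 hzero x
    (Finset.mem_univ x)
  exact sub_eq_zero.1 (pow_eq_zero_iff two_ne_zero |>.1 this)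

end Eigenvectors

/-! ### From singular vectors to point counts -/

section PointCounts

variable {K V : Type*} [Field K] [AddCommGroup V] [Module K V] {Q : QuadraticForm K V}
  {H : Submodule K V}

theorem perp_span_singleton (a : V) : perp Q (K ∙ a) = orth Q a := by
  ext v
  rw [mem_orth]
  constructor
  · intro h
    simpa using h a (Submodule.mem_span_singleton_self a)
  · intro h n hn
    obtain ⟨c, rfl⟩ := Submodule.mem_span_singleton.1 hn
    simp [h]

theorem QuadricPoint.exists_vector (p : QuadricPoint Q) :
    ∃ a : V, a ≠ 0 ∧ Q a = 0 ∧ p.1.submodule = K ∙ a ∧ perp Q p.1.submodule = orth Q a := by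
  have h := p.1.submodule_eq
  refine ⟨p.1.rep, p.1.rep_nonzero, p.2 _ ?_, h, ?_⟩
  · rw [h]
    exact Submodule.mem_span_singleton_self _
  · rw [h, perp_span_singleton]

theorem QuadricPoint.le_perp_self (p : QuadricPoint Q) :
    p.1.submodule ≤ perp Q p.1.submodule := by
  obtain ⟨a, -, hQa, hp, hperp⟩ := p.exists_vector
  rw [hperp, hp, Submodule.span_singleton_le_iff_mem, mem_orth]
  exact polar_self_of_singular hQa

theorem le_perp_comm {p p' : QuadricPoint Q} :
    p'.1.submodule ≤ perp Q p.1.submodule ↔ p.1.submodule ≤ perp Q p'.1.submodule := by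
  obtain ⟨a, -, -, hp, hperp⟩ := p.exists_vector
  obtain ⟨b, -, -, hp', hperp'⟩ := p'.exists_vector
  rw [hperp, hperp', hp, hp', Submodule.span_singleton_le_iff_mem,
    Submodule.span_singleton_le_iff_mem, mem_orth, mem_orth, QuadraticMap.polar_comm]

variable [Fintype K] [Finite V]

theorem IsEllipticQuadric.pointCount_perp (hQ : IsEllipticQuadric Q) (p : QuadricPoint Q) :
    (pointCount Q (perp Q p.1.submodule) : ℤ) = Fintype.card K ^ 3 + Fintype.card K + 1 := by
  obtain ⟨a, ha0, hQa, -, hperp⟩ := p.exists_vector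
  apply pointCount_eq
  rw [hperp, hQ.singularCount_orth ha0 hQa]
  ring

theorem IsEllipticQuadric.pointCount_top (hQ : IsEllipticQuadric Q) (p : QuadricPoint Q) :
    (pointCount Q (⊤ : Submodule K V) : ℤ) =
      (Fintype.card K + 1) * (Fintype.card K ^ 3 + 1) := by
  obtain ⟨a, ha0, hQa, -, -⟩ := p.exists_vector
  apply pointCount_eq
  rw [hQ.singularCount_top ha0 hQa]
  ring

theorem IsParabolicHyperplane.pointCount (hH : IsParabolicHyperplane Q H) :
    (pointCount Q H : ℤ) = (Fintype.card K + 1) * (Fintype.card K ^ 2 + 1) := by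
  apply pointCount_eq
  rw [hH.isNonsingularOn.singularCount_odd 2 hH.finrank_eq]
  ring

theorem IsEllipticQuadric.pointCount_perp_inf_perp (hQ : IsEllipticQuadric Q)
    {p p' : QuadricPoint Q} (h : ¬ p'.1.submodule ≤ perp Q p.1.submodule) :
    (pointCount Q (perp Q p.1.submodule ⊓ perp Q p'.1.submodule) : ℤ) =
      Fintype.card K ^ 2 + 1 := by
  obtain ⟨a, ha0, hQa, hp, hperp⟩ := p.exists_vector
  obtain ⟨b, hb0, hQb, hp', hperp'⟩ := p'.exists_vector
  rw [hperp, hp', Submodule.span_singleton_le_iff_mem, mem_orth] at h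
  apply pointCount_eq
  rw [hperp, hperp', hQ.singularCount_orth_inf_orth hQa hQb h]
  ring

theorem IsEllipticQuadric.pointCount_perp_inf_perp_of_adj (hQ : IsEllipticQuadric Q)
    {p p' : QuadricPoint Q} (h : (collinearityGraph Q).Adj p p') :
    (pointCount Q (perp Q p.1.submodule ⊓ perp Q p'.1.submodule) : ℤ) = Fintype.card K + 1 := by
  obtain ⟨hne, h⟩ := h
  obtain ⟨a, ha0, hQa, hp, hperp⟩ := p.exists_vector
  obtain ⟨b, hb0, hQb, hp', hperp'⟩ := p'.exists_vector
  rw [hperp, hp', Submodule.span_singleton_le_iff_mem, mem_orth] at h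
  apply pointCount_eq
  rw [hperp, hperp', hQ.singularCount_orth_inf_orth_of_collinear hQa hQb h]
  · push_cast
    ring
  · rw [LinearIndependent.pair_iff' ha0]
    rintro c rfl
    have hc : c ≠ 0 := by
      rintro rfl
      simp at hb0
    apply hne
    apply Subtype.ext
    apply Projectivization.submodule_injective
    rw [hp, hp', Submodule.span_singleton_smul_eq (IsUnit.mk0 c hc)]

theorem IsEllipticQuadric.pointCount_inf_perp_of_not_le (hQ : IsEllipticQuadric Q)
    (hH : IsParabolicHyperplane Q H) {p : QuadricPoint Q} (h : ¬ p.1.submodule ≤ H) :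
    (pointCount Q (H ⊓ perp Q p.1.submodule) : ℤ) = Fintype.card K ^ 2 + 1 := by
  obtain ⟨a, ha0, hQa, hp, hperp⟩ := p.exists_vector
  rw [hp, Submodule.span_singleton_le_iff_mem] at h
  apply pointCount_eq
  rw [hperp, hQ.singularCount_inf_orth_of_notMem hH hQa h]
  ring

theorem IsParabolicHyperplane.pointCount_inf_perp_of_le (hH : IsParabolicHyperplane Q H)
    {p : QuadricPoint Q} (h : p.1.submodule ≤ H) :
    (_root_.pointCount Q (H ⊓ perp Q p.1.submodule) : ℤ) =
      Fintype.card K ^ 2 + Fintype.card K + 1 := by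
  obtain ⟨a, ha0, hQa, hp, hperp⟩ := p.exists_vector
  rw [hp, Submodule.span_singleton_le_iff_mem] at h
  apply pointCount_eq
  rw [hperp, hH.singularCount_inf_orth_of_mem hQa ha0 h]
  ring

end PointCounts

/-! ### The matrix $b=A+I$ and its row sums -/

section Incidence

variable {K V : Type*} [Field K] [AddCommGroup V] [Module K V] {Q : QuadraticForm K V}
  {H : Submodule K V}

open Classical in
/-- The `0`-`1` matrix of the relation of being equal or collinear. -/
noncomputable def perpMatrix (Q : QuadraticForm K V) (p p' : QuadricPoint Q) : ℝ :=
  if p'.1.submodule ≤ perp Q p.1.submodule then 1 else 0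

theorem perpMatrix_comm (p p' : QuadricPoint Q) : perpMatrix Q p p' = perpMatrix Q p' p := by
  rw [perpMatrix, perpMatrix, le_perp_comm]

open Classical in
theorem perpMatrix_eq (p p' : QuadricPoint Q) :
    perpMatrix Q p p' =
      (if (collinearityGraph Q).Adj p p' then 1 else 0) + if p = p' then 1 else 0 := by
  by_cases h : p = p'
  · subst h
    simp [perpMatrix, p.le_perp_self]
  · simp [perpMatrix, collinearityGraph, h]

section

variable [Finite V]

open Classical in
theorem sum_ite_le (W : Submodule K V) :
    ∑ p : QuadricPoint Q, (if p.1.submodule ≤ W then (1 : ℝ) else 0) = pointCount Q W := by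
  rw [Finset.sum_boole, pointCount, Nat.card_eq_fintype_card, Fintype.card_subtype]

theorem sum_perpMatrix_mul_perpMatrix (p p' : QuadricPoint Q) :
    ∑ z, perpMatrix Q p z * perpMatrix Q p' z =
      pointCount Q (perp Q p.1.submodule ⊓ perp Q p'.1.submodule) := by
  classical
  rw [← sum_ite_le]
  refine Finset.sum_congr rfl fun z _ => ?_
  rw [perpMatrix, perpMatrix, le_inf_iff]
  split_ifs <;> simp_all

open Classical in
theorem sum_perpMatrix_filter (p : QuadricPoint Q) :
    ∑ z with ¬ z.1.submodule ≤ H, perpMatrix Q p z =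
      pointCount Q (perp Q p.1.submodule) - pointCount Q (H ⊓ perp Q p.1.submodule) := by
  rw [← sum_ite_le, ← sum_ite_le, Finset.sum_filter, ← Finset.sum_sub_distrib]
  refine Finset.sum_congr rfl fun z _ => ?_
  rw [perpMatrix, le_inf_iff]
  split_ifs <;> simp_all

end

variable [Fintype K] [Finite V]

open Classical in
-- Common perps contain $q^2+1$, $q+1$ or $q^3+q+1$ points for non-collinear, collinear and equal
-- pairs. The first is the constant term, and the successive differences $q-q^2$ and $q^3$ are the
-- other two coefficients.
theorem IsEllipticQuadric.sum_perpMatrix_mul_perpMatrix_eq (hQ : IsEllipticQuadric Q)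
    (p p' : QuadricPoint Q) :
    ∑ z, perpMatrix Q p z * perpMatrix Q p' z =
      ((Fintype.card K : ℝ) - (Fintype.card K : ℝ) ^ 2) * perpMatrix Q p p' +
        (if p = p' then (Fintype.card K : ℝ) ^ 3 else 0) + ((Fintype.card K : ℝ) ^ 2 + 1) := by
  rw [sum_perpMatrix_mul_perpMatrix, ← Int.cast_natCast (R := ℝ)]
  by_cases h : p = p'
  · subst h
    rw [inf_idem, hQ.pointCount_perp, if_pos rfl, perpMatrix, if_pos p.le_perp_self]
    push_cast
    ring
  · rw [if_neg h, perpMatrix]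
    split_ifs with hp
    · rw [hQ.pointCount_perp_inf_perp_of_adj ⟨h, hp⟩]
      push_cast
      ring
    · rw [hQ.pointCount_perp_inf_perp hp]
      push_cast
      ring

theorem IsEllipticQuadric.sum_perpMatrix (hQ : IsEllipticQuadric Q) (p : QuadricPoint Q) :
    ∑ z, perpMatrix Q p z = (Fintype.card K : ℝ) ^ 3 + Fintype.card K + 1 := by
  have h := sum_ite_le (Q := Q) (perp Q p.1.submodule)
  rw [← Int.cast_natCast (R := ℝ), hQ.pointCount_perp] at h
  push_cast at h
  rw [← h]
  rfl

open Classical in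
theorem IsEllipticQuadric.sum_perpMatrix_filter_of_not_le (hQ : IsEllipticQuadric Q)
    (hH : IsParabolicHyperplane Q H) {p : QuadricPoint Q} (h : ¬ p.1.submodule ≤ H) :
    ∑ z with ¬ z.1.submodule ≤ H, perpMatrix Q p z =
      (Fintype.card K : ℝ) ^ 3 - (Fintype.card K : ℝ) ^ 2 + Fintype.card K := by
  rw [sum_perpMatrix_filter, ← Int.cast_natCast (R := ℝ), ← Int.cast_natCast (R := ℝ),
    hQ.pointCount_perp, hQ.pointCount_inf_perp_of_not_le hH h]
  push_cast
  ring

open Classical in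
-- The value is smaller by exactly $q$ than for a point off `H`; this gap is what makes the final
-- neighbour counts uniform.
theorem IsEllipticQuadric.sum_perpMatrix_filter_of_le (hQ : IsEllipticQuadric Q)
    (hH : IsParabolicHyperplane Q H) {p : QuadricPoint Q} (h : p.1.submodule ≤ H) :
    ∑ z with ¬ z.1.submodule ≤ H, perpMatrix Q p z =
      (Fintype.card K : ℝ) ^ 3 - (Fintype.card K : ℝ) ^ 2 := by
  rw [sum_perpMatrix_filter, ← Int.cast_natCast (R := ℝ), ← Int.cast_natCast (R := ℝ),
    hQ.pointCount_perp, hH.pointCount_inf_perp_of_le h]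
  push_cast
  ring

open Classical in
theorem IsEllipticQuadric.card_filter_not_le (hQ : IsEllipticQuadric Q)
    (hH : IsParabolicHyperplane Q H) (p : QuadricPoint Q) :
    ((Finset.univ.filter fun z : QuadricPoint Q => ¬ z.1.submodule ≤ H).card : ℝ) =
      (Fintype.card K : ℝ) ^ 2 * ((Fintype.card K : ℝ) ^ 2 - 1) := by
  have h1 : ((Finset.univ.filter fun z : QuadricPoint Q => ¬ z.1.submodule ≤ H).card : ℝ) =
      pointCount Q (⊤ : Submodule K V) - pointCount Q H := by
    rw [← sum_ite_le, ← sum_ite_le, ← Finset.sum_sub_distrib, Finset.card_filter, Nat.cast_sum]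
    refine Finset.sum_congr rfl fun z _ => ?_
    split_ifs <;> simp_all
  rw [h1, ← Int.cast_natCast (R := ℝ), ← Int.cast_natCast (R := ℝ), hQ.pointCount_top p,
    hH.pointCount]
  push_cast
  ring

end Incidence

/-! ### Intriguing sets from neighbour counts -/

section IntriguingSets

variable {α : Type*} [Fintype α]

theorem Set.sum_indicator_one (Y : Set α) : ∑ y, Y.indicator (1 : α → ℝ) y = Y.ncard := by
  classical
  rw [Set.ncard_eq_toFinset_card', ← Set.filter_mem_univ_eq_toFinset, ← Finset.sum_boole]
  exact Finset.sum_congr rfl fun y _ => by simp [Set.indicator_apply]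

open Classical in
theorem SimpleGraph.sum_ite_adj_mul_indicator (G : SimpleGraph α) (Y : Set α) (x : α) :
    ∑ y, (if G.Adj x y then (1 : ℝ) else 0) * Y.indicator 1 y = {y | y ∈ Y ∧ G.Adj x y}.ncard := by
  rw [Set.ncard_eq_toFinset_card', Set.toFinset_ofPred, ← Finset.sum_boole]
  refine Finset.sum_congr rfl fun y _ => ?_
  by_cases hy : y ∈ Y <;> simp [hy]

open Classical in
theorem SimpleGraph.mem_adjEigenspace {G : SimpleGraph α} {θ : ℝ} {f : α → ℝ} :
    f ∈ G.adjEigenspace θ ↔ ∀ x, ∑ y, (if G.Adj x y then (1 : ℝ) else 0) * f y = θ * f x := by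
  rw [SimpleGraph.adjEigenspace, Module.End.mem_eigenspace_iff, Matrix.toLin'_apply, funext_iff]
  refine forall_congr' fun x => ?_
  simp [Matrix.mulVec, dotProduct, SimpleGraph.adjMatrix_apply]

open Classical in
/-- In a regular graph of degree `k ≠ θ`, a nonempty proper set `Y` is intriguing for `θ` as soon
as the numbers of neighbours in `Y` have the form `θ χ + m`. -/
theorem SimpleGraph.isIntriguingFor_of_ncard {G : SimpleGraph α} {θ k m : ℝ} (hk : k ≠ θ)
    (hreg : ∀ x, ∑ y, (if G.Adj x y then (1 : ℝ) else 0) = k) {Y : Set α} (hne : Y.Nonempty)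
    (huniv : Y ≠ Set.univ)
    (h : ∀ x, ({y | y ∈ Y ∧ G.Adj x y}.ncard : ℝ) = θ * Y.indicator 1 x + m) :
    G.IsIntriguingFor θ Y := by
  obtain ⟨x₁, hx₁⟩ := hne
  obtain ⟨x₂, hx₂⟩ := (Set.ne_univ_iff_exists_notMem Y).1 huniv
  refine ⟨⟨x₁, hx₁⟩, huniv, ⟨{y | y ∈ Y ∧ G.Adj x₁ y}.ncard, {y | y ∈ Y ∧ G.Adj x₂ y}.ncard,
    fun x hx => ?_, fun x hx => ?_⟩, ?_⟩
  · apply Nat.cast_injective (R := ℝ)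
    rw [h, h, Set.indicator_of_mem hx, Set.indicator_of_mem hx₁]
    rfl
  · apply Nat.cast_injective (R := ℝ)
    rw [h, h, Set.indicator_of_notMem hx, Set.indicator_of_notMem hx₂]
  -- Requiring $A(\chi_Y-dj)=\theta(\chi_Y-dj)$ with $A\chi_Y=\theta\chi_Y+mj$ and $Aj=kj$ forces
  -- $m=d(k-\theta)$.
  · set d := m / (k - θ) with hd
    have hd' : d * (k - θ) = m := div_mul_cancel₀ _ (sub_ne_zero.2 hk)
    refine Submodule.mem_sup.2 ⟨d • (1 : α → ℝ),
      Submodule.smul_mem _ _ (Submodule.mem_span_singleton_self _),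
      Y.indicator 1 - d • (1 : α → ℝ), SimpleGraph.mem_adjEigenspace.2 fun x => ?_, by simp⟩
    simp only [Pi.sub_apply, Pi.smul_apply, Pi.one_apply, smul_eq_mul, mul_one, mul_sub,
      Finset.sum_sub_distrib, ← Finset.sum_mul, hreg, G.sum_ite_adj_mul_indicator, h]
    linear_combination -hd'

end IntriguingSets

/-! ### Transfer from $(X,R_3)$ to the whole quadric -/

section Main

variable {K V : Type*} [Field K] [AddCommGroup V] [Module K V]
  {Q : QuadraticForm K V} {H : Submodule K V}

/-- The line through $v$ and $v^\sigma$ contains the pole of `H`, so a point collinear to both would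
lie in `H`; the condition on $v^\sigma$ is automatic. -/
theorem graphR3_adj_iff (hQ : IsEllipticQuadric Q) (hH : IsParabolicHyperplane Q H)
    {u v : OffPoint Q H} : (graphR3 hQ hH).Adj u v ↔ (collinearityGraph Q).Adj u.1 v.1 :=
  ⟨fun h => h.1, fun h => ⟨h, not_adj_conjugatePoint hQ hH h⟩⟩

open Classical in
theorem sum_filter_not_le [Finite V] (f : QuadricPoint Q → ℝ) :
    ∑ p with ¬ p.1.submodule ≤ H, f p = ∑ u : OffPoint Q H, f u.1 :=
  Finset.sum_subtype _ (fun p => by simp) f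

variable [Fintype K] [Finite V]

open Classical in
/-- A set of points off `H` which is intriguing for `q - 1` in the graph `(X, R₃)` has `q - 1`
times its characteristic vector plus a constant as neighbourhood count in the whole quadric. -/
theorem ncard_collinear_eq (hQ : IsEllipticQuadric Q) (hH : IsParabolicHyperplane Q H)
    {Y : Set (OffPoint Q H)}
    (hY : (graphR3 hQ hH).IsIntriguingFor ((Fintype.card K : ℝ) - 1) Y) (p : QuadricPoint Q) :
    ({z | z ∈ Subtype.val '' Y ∧ (collinearityGraph Q).Adj p z}.ncard : ℝ) =
      ((Fintype.card K : ℝ) - 1) * (Subtype.val '' Y).indicator 1 p +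
        (Y.ncard : ℝ) / ((Fintype.card K : ℝ) + 1) := by
  obtain ⟨-, -, -, hmem⟩ := hY
  have hq : (1 : ℝ) < Fintype.card K := by exact_mod_cast Fintype.one_lt_card (α := K)
  set q : ℝ := (Fintype.card K : ℝ)
  obtain ⟨f, hf, w₀, hw₀, hfw⟩ := Submodule.mem_sup.1 hmem
  obtain ⟨c, rfl⟩ := Submodule.mem_span_singleton.1 hf
  rw [SimpleGraph.mem_adjEigenspace] at hw₀
  set S : Finset (QuadricPoint Q) := Finset.univ.filter fun z => ¬ z.1.submodule ≤ H with hS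
  set w : QuadricPoint Q → ℝ := fun z => if h : ¬ z.1.submodule ≤ H then w₀ ⟨z, h⟩ else 0 with hw
  have hwS : ∀ z, z ∉ S → w z = 0 := fun z hz => dif_neg (by simpa [hS] using hz)
  have hwu : ∀ u : OffPoint Q H, w u.1 = w₀ u := fun u => dif_pos u.2
  have hsumw : ∀ g : QuadricPoint Q → ℝ,
      ∑ z, g z * w z = ∑ u : OffPoint Q H, g u.1 * w₀ u := by
    intro g
    simp only [← hwu]
    rw [← sum_filter_not_le fun z => g z * w z]
    refine (Finset.sum_subset (Finset.subset_univ _) fun z _ hz => ?_).symm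
    rw [hwS z hz, mul_zero]
  -- The identity part of $b=A+I$ raises the eigenvalue from $q-1$ to $q$.
  have heig : ∀ x ∈ S, ∑ z, perpMatrix Q x z * w z = q * w x := by
    intro x hx
    have hx : ¬ x.1.submodule ≤ H := by simpa [hS] using hx
    rw [hsumw, hwu ⟨x, hx⟩]
    have h1 := hw₀ ⟨x, hx⟩
    simp only [graphR3_adj_iff] at h1
    have h2 : ∀ u : OffPoint Q H, (if x = u.1 then (1 : ℝ) else 0) * w₀ u =
        if (⟨x, hx⟩ : OffPoint Q H) = u then w₀ u else 0 := by
      intro u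
      simp [Subtype.ext_iff]
    simp only [perpMatrix_eq, add_mul, Finset.sum_add_distrib, h1, h2, Finset.sum_ite_eq,
      Finset.mem_univ, if_true]
    ring
  -- Summing $bw$ over `S` gives $q\sum w$ by rows and $(q^3-q^2+q)\sum w$ by columns; these factors
  -- differ by $q^2(q-1)\ne 0$.
  have hsum : ∑ z, w z = 0 := by
    have h1 : ∑ x ∈ S, ∑ z, perpMatrix Q x z * w z = q * ∑ z, w z := by
      rw [Finset.sum_congr rfl heig, ← Finset.mul_sum,
        Finset.sum_subset (Finset.subset_univ S) fun z _ hz => hwS z hz]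
    have h2 : ∀ z, ∑ x ∈ S, perpMatrix Q x z * w z = (q ^ 3 - q ^ 2 + q) * w z := by
      intro z
      by_cases hz : z ∈ S
      · rw [← Finset.sum_mul, Finset.sum_congr rfl fun x _ => perpMatrix_comm x z,
          hQ.sum_perpMatrix_filter_of_not_le hH (by simpa [hS] using hz)]
      · simp [hwS z hz]
    rw [Finset.sum_comm, Finset.sum_congr rfl fun z _ => h2 z, ← Finset.mul_sum] at h1
    have h3 : (q ^ 2 * (q - 1)) * ∑ z, w z = 0 := by linear_combination h1
    exact (mul_eq_zero.1 h3).resolve_left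
      (mul_ne_zero (pow_ne_zero _ (by linarith)) (by linarith))
  have hchi : ∀ z, (Subtype.val '' Y).indicator (1 : QuadricPoint Q → ℝ) z =
      (if z ∈ S then c else 0) + w z := by
    intro z
    by_cases hz : z ∈ S
    · have hz' : ¬ z.1.submodule ≤ H := by simpa [hS] using hz
      have h1 := congrFun hfw ⟨z, hz'⟩
      rw [if_pos hz, hwu ⟨z, hz'⟩]
      simp only [Pi.add_apply, Pi.smul_apply, Pi.one_apply, smul_eq_mul, mul_one] at h1
      rw [h1]
      by_cases hy : (⟨z, hz'⟩ : OffPoint Q H) ∈ Y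
      · rw [Set.indicator_of_mem hy, Set.indicator_of_mem (Set.mem_image_of_mem Subtype.val hy)]
        rfl
      · rw [Set.indicator_of_notMem hy, Set.indicator_of_notMem]
        rintro ⟨u, hu, rfl⟩
        exact hy hu
    · rw [if_neg hz, hwS z hz, add_zero, Set.indicator_of_notMem]
      rintro ⟨u, hu, rfl⟩
      exact hz (by simpa [hS] using u.2)
  -- Since `w` has zero sum, $|Y|=c|X|=cq^2(q^2-1)$.
  have hc : c * (q ^ 2 * (q - 1)) = (Y.ncard : ℝ) / (q + 1) := by
    rw [eq_div_iff (by linarith)]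
    rw [← Set.ncard_image_of_injective Y Subtype.val_injective, ← Set.sum_indicator_one,
      Finset.sum_congr rfl fun z _ => hchi z, Finset.sum_add_distrib, hsum, add_zero,
      Finset.sum_ite_mem, Finset.univ_inter, Finset.sum_const, nsmul_eq_mul,
      hQ.card_filter_not_le hH p]
    ring
  have hw' := eigenvector_of_eigenvector_on perpMatrix_comm hwS
    (fun x _ y _ => hQ.sum_perpMatrix_mul_perpMatrix_eq x y) heig hsum p
  have hrow : ∑ z, perpMatrix Q p z * (Subtype.val '' Y).indicator (1 : QuadricPoint Q → ℝ) z =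
      c * (∑ z ∈ S, perpMatrix Q p z) + q * w p := by
    rw [Finset.sum_congr rfl fun z _ => by rw [hchi z, mul_add], Finset.sum_add_distrib, hw']
    congr 1
    simp only [mul_ite, mul_zero, Finset.sum_ite_mem, Finset.univ_inter]
    rw [← Finset.sum_mul, mul_comm]
  rw [← SimpleGraph.sum_ite_adj_mul_indicator, ← hc]
  have hp := hchi p
  -- On `S`, $w=\chi_Y-c$ turns $c(q^3-q^2+q)+qw$ into $c(q^3-q^2)+q\chi_Y$; off `S`, both $w$ and
  -- $\chi_Y$ vanish and the same expression results. Removing the identity part of $b$ leaves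
  -- $q-1$.
  by_cases hpS : p ∈ S
  · rw [hQ.sum_perpMatrix_filter_of_not_le hH (p := p) (by simpa [hS] using hpS)] at hrow
    simp only [perpMatrix_eq, add_mul, Finset.sum_add_distrib, ite_mul, one_mul, zero_mul,
      Finset.sum_ite_eq, Finset.mem_univ, if_true] at hrow ⊢
    rw [if_pos hpS] at hp
    linear_combination hrow - q * hp
  · rw [hQ.sum_perpMatrix_filter_of_le hH (p := p) (by simpa [hS] using hpS)] at hrow
    simp only [perpMatrix_eq, add_mul, Finset.sum_add_distrib, ite_mul, one_mul, zero_mul,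
      Finset.sum_ite_eq, Finset.mem_univ, if_true] at hrow ⊢
    rw [if_neg hpS] at hp
    linear_combination hrow - q * hp

end Main

theorem mainTheorem8 {K V : Type*} [Field K] [Fintype K] [AddCommGroup V] [Module K V] [Finite V]
    (hq : 2 < Fintype.card K)
    (Q : QuadraticForm K V) (hQ : IsEllipticQuadric Q)
    (H : Submodule K V) (hH : IsParabolicHyperplane Q H)
    (Y : Set (OffPoint Q H))
    (hY : (graphR3 hQ hH).IsIntriguingFor ((Fintype.card K : ℝ) - 1) Y) :
    IsTightSet Q (Subtype.val '' Y) ∧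
      ∀ p : QuadricPoint Q, p.1.submodule ≤ H →
        ({y : OffPoint Q H | y ∈ Y ∧ (collinearityGraph Q).Adj p y.1}.ncard : ℚ) =
          (Y.ncard : ℚ) / ((Fintype.card K : ℚ) + 1) := by
  classical
  have hcount := fun p => ncard_collinear_eq hQ hH hY p
  have hpos : (0 : ℝ) < Fintype.card K := by exact_mod_cast Fintype.card_pos
  refine ⟨?_, fun p hp => ?_⟩
  · refine SimpleGraph.isIntriguingFor_of_ncard
      (k := (Fintype.card K : ℝ) ^ 3 + Fintype.card K) ?_ (fun x => ?_) (hY.1.image _) ?_ hcount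
    · intro h
      have : (0 : ℝ) < (Fintype.card K : ℝ) ^ 3 := by positivity
      linarith
    · have h := hQ.sum_perpMatrix x
      simp only [perpMatrix_eq, Finset.sum_add_distrib, Finset.sum_ite_eq, Finset.mem_univ,
        if_true] at h
      linarith
    · intro h
      refine hY.2.1 (Set.eq_univ_of_forall fun u => ?_)
      obtain ⟨v, hv, hvu⟩ : u.1 ∈ Subtype.val '' Y := h ▸ Set.mem_univ _
      rwa [← Subtype.ext hvu]
  · have h := hcount p
    rw [Set.indicator_of_notMem, mul_zero, zero_add] at h
    · have himage : {z | z ∈ Subtype.val '' Y ∧ (collinearityGraph Q).Adj p z} =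
          Subtype.val '' {y : OffPoint Q H | y ∈ Y ∧ (collinearityGraph Q).Adj p y.1} := by
        ext z
        constructor
        · rintro ⟨⟨y, hy, rfl⟩, hz⟩
          exact ⟨y, ⟨hy, hz⟩, rfl⟩
        · rintro ⟨y, ⟨hy, hz⟩, rfl⟩
          exact ⟨⟨y, hy, rfl⟩, hz⟩
      rw [himage, Set.ncard_image_of_injective _ Subtype.val_injective] at h
      apply Rat.cast_injective (α := ℝ)
      push_cast
      exact h
    · rintro ⟨u, -, rfl⟩
      exact u.2 hp
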